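/- Let $D$ be an (oriented) virtual link diagram, i.e. a family of oriented closed curves generically immersed in the plane, each of whose finitely many transverse double points is either a real crossing (with over/under information) or a virtual crossing. Let $(\Sigma, D_\Sigma)$ be the abstract link diagram associated with $D$: the ribbon surface obtained by taking a disc around each real crossing, joining these discs by untwisted bands along the arcs of $D$ (bands pass through virtual crossings without meeting), and taking an annulus for each component without real crossings, together with the link diagram $D_\Sigma$ formed by the cores. Let $F$ be a closed surface, possibly non-orientable, and let $(F, D_F)$ be a link diagram realization of $D$, i.e. $D_F=f(D_\Sigma)$ for an embedding $f:\Sigma\to F$. A surface pole state $s$ of $(F,D_F)$ is obtained by applying an A-splice or a B-splice at each real crossing of $D_F$. It is a collection of disjoint simple closed curves in $F$. At each crossing whose splice does not respect the orientation of $D_F$ (B-splice at a positive crossing, A-splice at a negative one), the arc joining the two incoming ends carries a sink pole and the arc joining the two outgoing ends carries a source pole, each pole lying on the side of its arc that faces the other arc. A pole reduction removes from a pole curve two poles, a sink and a source, that are adjacent on the curve and lie on the same side of it. A pole curve is irreducible if no pole reduction applies, and the index $\iota(l)$ of a pole curve $l$ is half of the number of poles of an irreducible pole curve obtained from $l$ by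 pole reductions. Let $l$ be a pole curve of a surface pole state $s$ of $(F,D_F)$. If $\iota(l)>0$, then $l$ is not a separating curve in $F$, i.e. the complement of $l$ in the connected component of $F$ that contains $l$ is connected. -/

import Mathlib

open scoped ContDiff

/-! ## Gauss data and the surface of an abstract link diagram -/

/-- The Gauss diagram of an oriented virtual link diagram. A passage `(c, b)` is the passage of the
link through the real crossing `c` along its over strand (`b = true`) or under strand
(`b = false`). `next p` is the passage which follows `p` along the oriented link, `positive c`
says whether `c` is a positive crossing, and `Loop` indexes the components of the link that pass
through no real crossing. -/
structure GaussDiagram where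
  Crossing : Type
  [fintypeCrossing : Fintype Crossing]
  next : Equiv.Perm (Crossing × Bool)
  positive : Crossing → Bool
  Loop : Type
  [fintypeLoop : Fintype Loop]

namespace GaussDiagram

attribute [instance] GaussDiagram.fintypeCrossing GaussDiagram.fintypeLoop

/-- The plaque around a crossing: the square `[-1, 1]²` without its four corners (a cross-shaped
neighbourhood of the crossing, with four ends). The two strands are the segments on the coordinate
axes, both oriented in the direction of increasing coordinate. -/
abbrev Plaque : Type :=
  {z : ℝ × ℝ // |z.1| ≤ 1 ∧ |z.2| ≤ 1 ∧ (|z.1| < 1 ∨ |z.2| < 1)}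

variable (G : GaussDiagram)

abbrev Passage : Type := G.Crossing × Bool

variable {G} in
/-- The other passage through the same crossing. -/
def other (p : G.Passage) : G.Passage := (p.1, !p.2)

/-- Whether `p` runs along the horizontal axis of its plaque. Since (horizontal, vertical) is
the positive frame, the horizontal strand of a positive crossing is the over strand, and that of a
negative crossing is the under strand. -/
def horizontal (p : G.Passage) : Bool := p.2 == G.positive p.1

/-- The side of the plaque through which the passage `p` leaves; the parameter `t` is the
coordinate transverse to `p`, positive on the left of `p`. -/
def outSide (p : G.Passage) (t : Set.Ioo (-1 : ℝ) 1) : Plaque :=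
  have h : |(t : ℝ)| < 1 := abs_lt.mpr t.2
  if G.horizontal p then ⟨(1, t), by simp [h, h.le]⟩ else ⟨(-t, 1), by simp [h, h.le]⟩

/-- The side of the plaque through which the passage `p` enters; the parameter `t` is the
coordinate transverse to `p`, positive on the left of `p`. -/
def inSide (p : G.Passage) (t : Set.Ioo (-1 : ℝ) 1) : Plaque :=
  have h : |(t : ℝ)| < 1 := abs_lt.mpr t.2
  if G.horizontal p then ⟨(-1, t), by simp [h, h.le]⟩ else ⟨(-t, -1), by simp [h, h.le]⟩

/-- One plaque for each real crossing and one open annulus for each component without real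
crossings. -/
abbrev Pieces : Type :=
  (Σ _ : G.Crossing, Plaque) ⊕ (Σ _ : G.Loop, UnitAddCircle × Set.Ioo (-1 : ℝ) 1)

/-- For each arc of the link from a passage `p` to the following one, the outgoing end of `p` is
glued to the incoming end of `next p`, left to left and right to right (no twist). -/
inductive Glue : G.Pieces → G.Pieces → Prop
  | arc (p : G.Passage) (t : Set.Ioo (-1 : ℝ) 1) :
      Glue (.inl ⟨p.1, G.outSide p t⟩) (.inl ⟨(G.next p).1, G.inSide (G.next p) t⟩)

/-- The surface of the associated abstract link diagram, without its boundary: the open ribbon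
neighbourhood obtained by joining plaques at the real crossings along the arcs of the link. The
link diagram in it consists of the two axes of each plaque and the core of each annulus. -/
def Surface : Type := Quot G.Glue

instance : TopologicalSpace G.Surface := inferInstanceAs (TopologicalSpace (Quot G.Glue))

end GaussDiagram

/-! ## Poles, pole reductions and the index -/

/-- A sink pole (I-pole) or a source pole (O-pole). -/
inductive PoleKind
  | sink
  | source

/-- A side of a two-sided curve with respect to a direction of travel. -/
inductive Side
  | left
  | right

structure Pole where
  kind : PoleKind
  side : Side

/-- Pole reduction, on the cyclic sequence of the poles of a pole curve: a sink and a source which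
are adjacent on the curve and lie on the same side of it are removed. -/
inductive PoleReduction : Cycle Pole → Cycle Pole → Prop
  | cancel (p q : Pole) (w : List Pole) (hkind : p.kind ≠ q.kind) (hside : p.side = q.side) :
      PoleReduction ((p :: q :: w : List Pole) : Cycle Pole) (w : Cycle Pole)

/-- No pole reduction applies. -/
def PoleIrreducible (w : Cycle Pole) : Prop := ∀ w', ¬ PoleReduction w w'

/-- `k` is half of the number of poles of an irreducible pole curve obtained by pole reductions. -/
def HasIndex (w : Cycle Pole) (k : ℕ) : Prop :=
  ∃ w', Relation.ReflTransGen PoleReduction w w' ∧ PoleIrreducible w' ∧ w'.length = 2 * k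

/-! ## Splices, surface pole states and pole curves -/

inductive Splice
  | A
  | B

namespace GaussDiagram

variable (G : GaussDiagram)

/-- A surface pole state: the choice of a splice at each crossing. -/
abbrev PoleState : Type := G.Crossing → Splice

variable {G}

/-- Whether the splice respects the orientation of the link: the A-splice does so at a positive
crossing and the B-splice at a negative one. The two other splices produce a pair of poles. -/
def PoleState.coherent (s : G.PoleState) (c : G.Crossing) : Bool :=
  match s c with
  | .A => G.positive c
  | .B => !G.positive c

variable (G) in
/-- `(p, true)` is the arc of the link from `p` to `next p` traversed along the orientation of the
link, and `(p, false)` is the same arc traversed backwards. -/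
abbrev Dart : Type := G.Passage × Bool

/-- The passage at whose end a dart arrives: its incoming end for a forward dart, its outgoing end
for a backward one. -/
def arrival : G.Dart → G.Passage
  | (p, true) => G.next p
  | (p, false) => p

/-- The dart which follows a given one on the pole curve. A coherent splice joins the incoming end
of each passage to the outgoing end of the other one; an incoherent splice joins the two incoming
ends and the two outgoing ends. -/
def PoleState.step (s : G.PoleState) (e : G.Dart) : G.Dart :=
  match s.coherent (arrival e).1, e.2 with
  | true, true => (other (arrival e), true)
  | true, false => (G.next.symm (other (arrival e)), false)
  | false, true => (G.next.symm (other (arrival e)), false)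
  | false, false => (other (arrival e), true)

/-- The arc of the pole curve in the plaque at which the dart `e` arrives, from the end where `e`
enters the plaque to the end where `step e` leaves it. It is a segment which joins the midpoints of
two adjacent sides of the square. -/
def PoleState.plaqueArc (s : G.PoleState) (e : G.Dart) : Set Plaque :=
  match s.coherent (arrival e).1, e.2 with
  | true, true =>
      if G.horizontal (arrival e) then {z | z.1.2 - z.1.1 = 1} else {z | z.1.1 - z.1.2 = 1}
  | true, false =>
      if G.horizontal (arrival e) then {z | z.1.1 - z.1.2 = 1} else {z | z.1.2 - z.1.1 = 1}
  | false, true => {z | z.1.1 + z.1.2 = -1}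
  | false, false => {z | z.1.1 + z.1.2 = 1}

/-- The pole on the segment `plaqueArc e`, if any: a sink where the two incoming ends are joined, a
source where the two outgoing ends are joined. It lies on the side of the segment that faces the
crossing point `(0, 0)`; the side is given with respect to the direction of travel. -/
def PoleState.pole? (s : G.PoleState) (e : G.Dart) : Option Pole :=
  match s.coherent (arrival e).1, e.2 with
  | true, _ => none
  | false, true => some ⟨.sink, if G.horizontal (arrival e) then .left else .right⟩
  | false, false => some ⟨.source, if G.horizontal (arrival e) then .left else .right⟩

/-- The pole curves of a state: those that run through a given dart, and the components of the link
without real crossings. (The same curve is listed once for each dart on it, in both directions.) -/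
inductive PoleCurve (s : G.PoleState)
  | through (e : G.Dart)
  | free (i : G.Loop)

/-- The cyclic sequence of the poles on a pole curve, in the order of travel. -/
noncomputable def PoleCurve.poles {s : G.PoleState} : PoleCurve s → Cycle Pole
  | .through e =>
      (((List.range (Function.minimalPeriod s.step e)).filterMap
        fun n => s.pole? (s.step^[n] e) : List Pole) : Cycle Pole)
  | .free _ => Cycle.nil

/-- The underlying simple closed curve of a pole curve. -/
def PoleCurve.carrier {s : G.PoleState} : PoleCurve s → Set G.Surface
  | .through e =>
      ⋃ n : ℕ, (fun z => Quot.mk G.Glue (.inl ⟨(arrival (s.step^[n] e)).1, z⟩)) ''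
        s.plaqueArc (s.step^[n] e)
  | .free i => Set.range fun θ => Quot.mk G.Glue (.inr ⟨i, (θ, ⟨0, by norm_num⟩)⟩)

end GaussDiagram

/-! ## Virtual link diagrams -/

/-- A family of `n` closed curves in the plane, parametrized by `ℝ/ℤ`. -/
abbrev PlaneCurves (n : ℕ) : Type := Fin n → UnitAddCircle → ℂ

namespace PlaneCurves

variable {n : ℕ} (γ : PlaneCurves n)

/-- The image of a point of the parametrizing circles. -/
def image (P : Fin n × UnitAddCircle) : ℂ := γ P.1 P.2

noncomputable def velocity (P : Fin n × UnitAddCircle) : ℂ :=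
  deriv (fun t : ℝ => γ P.1 (P.2 + (t : UnitAddCircle))) 0

/-- The determinant of the velocities at `P` and `Q`. -/
noncomputable def det (P Q : Fin n × UnitAddCircle) : ℝ :=
  (γ.velocity P).re * (γ.velocity Q).im - (γ.velocity P).im * (γ.velocity Q).re

end PlaneCurves

/-- An oriented virtual link diagram: closed curves immersed in the plane with finitely many
multiple points, all of which are transverse double points. The set `real` lists each real crossing
once, as the pair (point on the over strand, point on the under strand); all other double points
are virtual crossings. -/
structure VirtualLinkDiagram where
  numComponents : ℕ
  curve : PlaneCurves numComponents
  smooth : ∀ i, ContDiff ℝ ∞ fun t : ℝ => curve i (t : UnitAddCircle)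
  immersed : ∀ P, curve.velocity P ≠ 0
  finite : {P | ∃ Q, Q ≠ P ∧ curve.image Q = curve.image P}.Finite
  no_triple : ∀ P Q R, curve.image P = curve.image Q → curve.image Q = curve.image R →
    P = Q ∨ Q = R ∨ P = R
  transverse : ∀ P Q, P ≠ Q → curve.image P = curve.image Q → curve.det P Q ≠ 0
  real : Finset ((Fin numComponents × UnitAddCircle) × (Fin numComponents × UnitAddCircle))
  real_double : ∀ c ∈ real, c.1 ≠ c.2 ∧ curve.image c.1 = curve.image c.2
  real_once : ∀ c ∈ real, c.swap ∉ real

namespace VirtualLinkDiagram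

variable (D : VirtualLinkDiagram)

/-- The real crossings. -/
abbrev Crossing : Type := {c // c ∈ D.real}

/-- The point of the parametrizing circles at which a real crossing is passed. -/
def point (p : D.Crossing × Bool) : Fin D.numComponents × UnitAddCircle :=
  if p.2 then p.1.1.1 else p.1.1.2

/-- Moving along the link from `p`, the first passage through a real crossing that is met is
`q` (which is `p` itself if there is no other one on its component). -/
def IsNext (p q : D.Crossing × Bool) : Prop :=
  ∃ τ : ℝ, 0 < τ ∧ D.point q = ((D.point p).1, (D.point p).2 + (τ : UnitAddCircle)) ∧
    ∀ τ' : ℝ, 0 < τ' → τ' < τ →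
      ∀ r, D.point r ≠ ((D.point p).1, (D.point p).2 + (τ' : UnitAddCircle))

theorem point_injective : Function.Injective D.point := by
  rintro ⟨⟨⟨P, Q⟩, hc⟩, b⟩ ⟨⟨⟨P', Q'⟩, hc'⟩, b'⟩ h
  have h1 := D.real_double _ hc
  have h2 := D.real_double _ hc'
  have h3 := D.real_once _ hc
  have key := D.no_triple
  simp only [Prod.swap_prod_mk] at h1 h2 h3
  obtain ⟨n1, e1⟩ := h1
  obtain ⟨n2, e2⟩ := h2
  cases b <;> cases b' <;> simp only [point, if_true, if_false, Bool.false_eq_true] at h <;> subst h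
  · rcases key P Q P' e1 e2.symm with h | h | h
    · exact absurd h n1
    · exact absurd h.symm n2
    · subst h; rfl
  · rcases key P Q Q' e1 e2 with h | h | h
    · exact absurd h n1
    · exact absurd h n2
    · subst h; exact absurd hc' h3
  · rcases key Q P P' e1.symm e2.symm with h | h | h
    · exact absurd h.symm n1
    · exact absurd h.symm n2
    · subst h; exact absurd hc' h3
  · rcases key Q P Q' e1.symm e2 with h | h | h
    · exact absurd h.symm n1
    · exact absurd h n2
    · subst h; rfl

theorem exists_isNext (p : D.Crossing × Bool) : ∃ q, D.IsNext p q := by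
  have hfin : (⋃ r : D.Crossing × Bool, {τ : ℝ | τ ∈ Set.Ioc (0 : ℝ) 1 ∧
      D.point r = ((D.point p).1, (D.point p).2 + (τ : UnitAddCircle))}).Finite := by
    refine Set.finite_iUnion fun r => Set.Subsingleton.finite ?_
    rintro τ ⟨h, hr⟩ τ' ⟨h', hr'⟩
    have e := (Prod.ext_iff.mp (hr.symm.trans hr')).2
    have e2 : (τ : UnitAddCircle) = (τ' : UnitAddCircle) := add_left_cancel e
    exact (AddCircle.coe_eq_coe_iff_of_mem_Ioc (p := (1 : ℝ)) (a := 0)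
      (by simpa using h) (by simpa using h')).mp e2
  have hne : (⋃ r : D.Crossing × Bool, {τ : ℝ | τ ∈ Set.Ioc (0 : ℝ) 1 ∧
      D.point r = ((D.point p).1, (D.point p).2 + (τ : UnitAddCircle))}).Nonempty := by
    refine ⟨1, Set.mem_iUnion.mpr ⟨p, by simp, ?_⟩⟩
    have : ((1 : ℝ) : UnitAddCircle) = 0 := AddCircle.coe_period (1 : ℝ)
    rw [this, add_zero]
  obtain ⟨τ, hτ, hmin⟩ := Set.exists_min_image _ id hfin hne
  obtain ⟨q, hτ1, hq⟩ := Set.mem_iUnion.mp hτ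
  refine ⟨q, τ, hτ1.1, hq, fun τ' h0 hlt r hr => ?_⟩
  exact absurd (hmin τ' (Set.mem_iUnion.mpr ⟨r, ⟨h0, hlt.le.trans hτ1.2⟩, hr⟩)) (not_le.mpr hlt)

theorem IsNext.injective {p p' q : D.Crossing × Bool} (h : D.IsNext p q) (h' : D.IsNext p' q) :
    p = p' := by
  have aux : ∀ {p p' : D.Crossing × Bool} {τ τ' : ℝ}, τ ≤ τ' → 0 < τ →
      D.point q = ((D.point p).1, (D.point p).2 + (τ : UnitAddCircle)) →
      D.point q = ((D.point p').1, (D.point p').2 + (τ' : UnitAddCircle)) →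
      (∀ t : ℝ, 0 < t → t < τ' →
        ∀ r, D.point r ≠ ((D.point p').1, (D.point p').2 + (t : UnitAddCircle))) → p = p' := by
    intro p p' τ τ' hle h0 hq hq' hno
    obtain ⟨e1, e2⟩ := Prod.ext_iff.mp (hq.symm.trans hq')
    have e3 : D.point p = ((D.point p').1, (D.point p').2 + ((τ' - τ : ℝ) : UnitAddCircle)) := by
      refine Prod.ext e1 ?_
      simp only at e2 ⊢
      rw [AddCircle.coe_sub, ← add_sub_assoc, ← e2, add_sub_cancel_right]
    rcases hle.eq_or_lt with rfl | hlt
    · refine D.point_injective (e3.trans ?_)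
      simp
    · exact absurd e3 (hno (τ' - τ) (by linarith) (by linarith) p)
  obtain ⟨τ, h0, hq, hno⟩ := h
  obtain ⟨τ', h0', hq', hno'⟩ := h'
  rcases le_total τ τ' with hle | hle
  · exact aux hle h0 hq hq' hno'
  · exact (aux hle h0' hq' hq hno).symm

/-- The passage that follows a given one along the link. -/
noncomputable def next : Equiv.Perm (D.Crossing × Bool) :=
  Equiv.ofBijective (fun p => (D.exists_isNext p).choose) <|
    Finite.injective_iff_bijective.mp fun p p' h => by
      have h1 := (D.exists_isNext p).choose_spec
      have h2 := (D.exists_isNext p').choose_spec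
      have h3 : (D.exists_isNext p).choose = (D.exists_isNext p').choose := h
      rw [← h3] at h2
      exact IsNext.injective D h1 h2

open Classical in
/-- The Gauss diagram of a virtual link diagram. A real crossing is positive if the frame
(velocity of the over strand, velocity of the under strand) is positive. -/
noncomputable def gaussDiagram : GaussDiagram where
  Crossing := D.Crossing
  next := D.next
  positive c := decide (0 < D.curve.det c.1.1 c.1.2)
  Loop := {i : Fin D.numComponents // ∀ p, (D.point p).1 ≠ i}

/-- A link diagram realization of `D` in `F`: an embedding, as an open subsurface of `F`, of the
surface of the abstract link diagram associated with `D`. The realized diagram is the image of the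
link diagram in that surface. -/
structure Realization (F : Type*) [TopologicalSpace F] where
  toFun : D.gaussDiagram.Surface → F
  isOpenEmbedding : Topology.IsOpenEmbedding toFun

end VirtualLinkDiagram

/-! ## Separating curves -/

/-- A subset `l` of `F` is separating if two points of its complement lie in the same connected
component of `F` but in different connected components of the complement of `l`. For connected `F`
this means that the complement of `l` is disconnected. -/
def IsSeparating {F : Type*} [TopologicalSpace F] (l : Set F) : Prop :=
  ∃ x ∈ lᶜ, ∃ y ∈ lᶜ, connectedComponent x = connectedComponent y ∧
    connectedComponentIn lᶜ x ≠ connectedComponentIn lᶜ y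

/-! Suppose the pole curve `l` separates. Let `U` be a component of its complement and `X` the trace
of `U` on the ribbon surface. The bands are untwisted, so `l` has two globally defined sides even if
`F` is non-orientable. If both sides lay in `X`, then `U ∪ l` would be open and closed; if neither
did, `U` would be. Both contradict separation, so exactly one side of `l` lies in `X`.

Give a crossing the colour 1 if its centre lies in `X`, and 0 otherwise, and count sinks minus
sources weighted by colour. The total is zero, since sinks and sources balance at each crossing
(`sum_mul_sign_of_crossing`). Every other pole curve contributes zero: it is connected and misses
`l`, so the colour is constant along it, and its poles alternate in kind (`sum_mul_sign_of_step`).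
Hence `l` contributes zero (`sum_orbit_eq_zero`). A pole faces the centre of its crossing, so on `l`
the colour records whether the pole lies on the side contained in `X`. The poles on that side are
therefore balanced; since all poles of `l` are balanced as well, so are those on the other side.

Side-weighted counts and alternation of kinds survive pole reduction. In an irreducible word the
sides alternate too, so all poles have the same weight for the weights `1` and `-1`, and a balanced
word must be empty (`HasIndex.eq_zero`). The index is then zero. -/

/-! ## The index of an alternating pole word -/

/-- The signed count of a pole (sinks positive), weighted by `a` on the left and `b` on the
right. -/
def Pole.weight (a b : ℤ) (p : Pole) : ℤ :=
  (match p.kind with | .sink => 1 | .source => -1) *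
    (match p.side with | .left => a | .right => b)

/-- The kinds of the poles alternate along the list; `b` and `b'` say whether one travels along the
orientation before the first and after the last pole. -/
def AlternatingPoles : Bool → List Pole → Bool → Prop
  | b, [], b' => b = b'
  | b, p :: w, b' => p.kind = cond b PoleKind.sink PoleKind.source ∧ AlternatingPoles (!b) w b'

theorem alternatingPoles_append {u v : List Pole} {b b' : Bool} :
    AlternatingPoles b (u ++ v) b' ↔
      ∃ c, AlternatingPoles b u c ∧ AlternatingPoles c v b' := by
  induction u generalizing b with
  | nil => simp [AlternatingPoles]
  | cons p u ih => simp [AlternatingPoles, ih, and_assoc]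

/-- Moving the first pole to the end starts the same closed walk one pole later, which only negates
the initial direction. -/
theorem AlternatingPoles.of_coe_eq {u v : List Pole} (h : (u : Cycle Pole) = v)
    (hu : ∃ b, AlternatingPoles b u b) : ∃ b, AlternatingPoles b v b := by
  obtain ⟨n, -, rfl⟩ := List.isRotated_iff_mod.mp (Cycle.coe_eq_coe.mp h)
  obtain ⟨b, hb⟩ := hu
  induction n with
  | zero => exact ⟨b, by simpa using hb⟩
  | succ n ih =>
    obtain ⟨c, hc⟩ := ih (Cycle.coe_eq_coe.mpr ⟨n, rfl⟩)
    rw [← List.rotate_rotate]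
    cases hl : u.rotate n with
    | nil => exact ⟨c, by simpa [hl] using hc⟩
    | cons p w =>
      rw [hl] at hc
      refine ⟨!c, ?_⟩
      rw [List.rotate_cons_succ, List.rotate_zero, alternatingPoles_append]
      exact ⟨c, hc.2, hc.1, rfl⟩

/-- The two cancelled poles have opposite kinds and a common side, hence opposite weights. -/
theorem PoleReduction.sum_weight {w w' : Cycle Pole} (h : PoleReduction w w') (a b : ℤ) :
    (w.toMultiset.map (Pole.weight a b)).sum = (w'.toMultiset.map (Pole.weight a b)).sum := by
  obtain ⟨⟨k, x⟩, ⟨k', x'⟩, w, hk, hs⟩ := h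
  cases k <;> cases k' <;> cases x <;> cases x' <;> simp_all [Pole.weight]

/-- Deleting two consecutive poles drops two changes of direction, which compensate each other. -/
theorem PoleReduction.alternating {w w' : Cycle Pole} (h : PoleReduction w w')
    (hw : ∃ (u : List Pole) (b : Bool), (u : Cycle Pole) = w ∧ AlternatingPoles b u b) :
    ∃ (u : List Pole) (b : Bool), (u : Cycle Pole) = w' ∧ AlternatingPoles b u b := by
  obtain ⟨p, q, v, -, -⟩ := h
  obtain ⟨u, b, hu, hb⟩ := hw
  obtain ⟨c, hc⟩ := AlternatingPoles.of_coe_eq hu ⟨b, hb⟩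
  exact ⟨v, c, rfl, by simpa using hc.2.2⟩

theorem AlternatingPoles.kind_ne {u v : List Pole} {p q : Pole} {b b' : Bool}
    (h : AlternatingPoles b (u ++ p :: q :: v) b') : p.kind ≠ q.kind := by
  obtain ⟨c, -, h1, h2, -⟩ := alternatingPoles_append.mp h
  cases c <;> simp_all

theorem PoleIrreducible.side_ne {u v : List Pole} {p q : Pole}
    (h : PoleIrreducible ((u ++ p :: q :: v : List Pole) : Cycle Pole)) (hk : p.kind ≠ q.kind) :
    p.side ≠ q.side := fun hs => by
  refine h ((v ++ u : List Pole) : Cycle Pole) ?_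
  have e : ((u ++ p :: q :: v : List Pole) : Cycle Pole) = (p :: q :: (v ++ u) : List Pole) :=
    Cycle.coe_eq_coe.mpr List.isRotated_append
  rw [e]
  exact .cancel p q _ hk hs

/-- Changing both kind and side leaves the weight for `1` and `-1` unchanged, so all summands are
equal. -/
theorem sum_weight_eq_length (p : Pole) (w : List Pole)
    (h : (p :: w).IsChain fun p q => p.kind ≠ q.kind ∧ p.side ≠ q.side) :
    ((p :: w).map (Pole.weight 1 (-1))).sum = p.weight 1 (-1) * (p :: w).length := by
  induction w generalizing p with
  | nil => simp
  | cons q w ih =>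
    rw [List.isChain_cons_cons] at h
    have e : p.weight 1 (-1) = q.weight 1 (-1) := by
      obtain ⟨k, x⟩ := p
      obtain ⟨k', x'⟩ := q
      cases k <;> cases k' <;> cases x <;> cases x' <;> simp_all [Pole.weight]
    rw [List.map_cons, List.sum_cons, ih q h.2, ← e]
    simp only [List.length_cons]
    push_cast
    ring

theorem sum_weight_eq (a b : ℤ) (w : Multiset Pole) :
    (w.map (Pole.weight a b)).sum =
      a * (w.map (Pole.weight 1 0)).sum + b * (w.map (Pole.weight 0 1)).sum := by
  rw [← Multiset.sum_map_mul_left, ← Multiset.sum_map_mul_left, ← Multiset.sum_map_add]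
  congr 2
  funext ⟨k, x⟩
  cases k <;> cases x <;> simp [Pole.weight]

/-- The index of an alternating pole word vanishes if the sinks and sources are balanced on both
sides. -/
theorem HasIndex.eq_zero {w : List Pole} {k : ℕ} {b : Bool} (hk : HasIndex (w : Cycle Pole) k)
    (hw : AlternatingPoles b w b) {a₁ a₂ : ℤ} (ha : a₁ ≠ a₂)
    (h1 : (w.map (Pole.weight a₁ a₂)).sum = 0) (h2 : (w.map (Pole.weight 1 1)).sum = 0) :
    k = 0 := by
  obtain ⟨w', hred, hirr, hlen⟩ := hk
  have key : (∃ (u : List Pole) (b : Bool), (u : Cycle Pole) = w' ∧ AlternatingPoles b u b) ∧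
      ∀ a b, (w'.toMultiset.map (Pole.weight a b)).sum = (w.map (Pole.weight a b)).sum := by
    clear hirr hlen
    induction hred with
    | refl => exact ⟨⟨w, b, rfl, hw⟩, fun a b => by simp⟩
    | tail _ h ih => exact ⟨h.alternating ih.1, fun a b => by rw [← h.sum_weight, ih.2]⟩
  obtain ⟨⟨u, c, rfl, hu⟩, hsum⟩ := key
  cases u with
  | nil => simp at hlen; omega
  | cons p u =>
    exfalso
    have hchain : (p :: u).IsChain fun p q => p.kind ≠ q.kind ∧ p.side ≠ q.side := by
      rw [List.isChain_iff_forall_rel_of_append_cons_cons]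
      intro q r v v' e
      rw [e] at hu hirr
      exact ⟨hu.kind_ne, hirr.side_ne hu.kind_ne⟩
    have h3 := sum_weight_eq_length p u hchain
    rw [← hsum, sum_weight_eq] at h1 h2
    have h4 := sum_weight_eq 1 (-1) ((p :: u : List Pole) : Multiset Pole)
    simp only [Cycle.coe_toMultiset] at h1 h2
    rw [Multiset.map_coe, Multiset.sum_coe, h3] at h4
    generalize (Multiset.map (Pole.weight 1 0) ((p :: u : List Pole) : Multiset Pole)).sum = x at *
    generalize (Multiset.map (Pole.weight 0 1) ((p :: u : List Pole) : Multiset Pole)).sum = y at *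
    -- Here `x` and `y` are the signed counts on the left and on the right, with `x + y = 0` and `a₁
    -- * x + a₂ * y = 0`.
    have hy : y = -x := by linarith
    subst hy
    have hx : x = 0 := by
      have : (a₁ - a₂) * x = 0 := by linarith
      exact (mul_eq_zero.mp this).resolve_left (sub_ne_zero.mpr ha)
    subst hx
    obtain ⟨k, x⟩ := p
    cases k <;> cases x <;> simp [Pole.weight] at h4 <;> omega

namespace GaussDiagram

variable {G : GaussDiagram}

/-! ## Darts -/

/-- The same arc of the link in the opposite direction. -/
def Dart.rev (e : G.Dart) : G.Dart := (e.1, !e.2)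

/-- A splice is a symmetric pairing of ends, so a pole curve can be retraced. This makes `step`
injective. -/
theorem PoleState.step_rev_step (s : G.PoleState) (e : G.Dart) :
    s.step (Dart.rev (s.step e)) = Dart.rev e := by
  obtain ⟨p, b⟩ := e
  cases b <;> cases h : s.coherent p.1 <;> cases h' : s.coherent (G.next p).1 <;>
    simp_all [PoleState.step, arrival, Dart.rev, other]

theorem Dart.rev_rev (e : G.Dart) : Dart.rev (Dart.rev e) = e := by simp [Dart.rev]

theorem PoleState.step_injective (s : G.PoleState) : Function.Injective s.step := fun e e' h => by
  have h1 := s.step_rev_step e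
  rw [h, s.step_rev_step] at h1
  rw [← Dart.rev_rev e, ← h1, Dart.rev_rev]

/-- The dart whose arc in its plaque of arrival is that of `e` traversed backwards. -/
def PoleState.flip (s : G.PoleState) (e : G.Dart) : G.Dart := Dart.rev (s.step e)

theorem PoleState.flip_flip (s : G.PoleState) (e : G.Dart) : s.flip (s.flip e) = e := by
  simp only [PoleState.flip, s.step_rev_step, Dart.rev_rev]

theorem PoleState.step_flip (s : G.PoleState) (e : G.Dart) : s.step (s.flip e) = Dart.rev e :=
  s.step_rev_step e

theorem PoleState.flip_step (s : G.PoleState) (e : G.Dart) :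
    s.step (s.flip (s.step e)) = s.flip e := s.step_rev_step _

/-- The crossing in whose plaque a dart arrives. -/
def arrivalCrossing (e : G.Dart) : G.Crossing := (arrival e).1

/-- The sign of the pole in the plaque of arrival, positive for a sink. -/
def PoleState.sign (s : G.PoleState) (e : G.Dart) : ℤ :=
  match s.coherent (arrivalCrossing e), e.2 with
  | true, _ => 0
  | false, true => 1
  | false, false => -1

theorem PoleState.arrivalCrossing_flip (s : G.PoleState) (e : G.Dart) :
    arrivalCrossing (s.flip e) = arrivalCrossing e := by
  obtain ⟨p, b⟩ := e
  cases b <;> cases h : s.coherent p.1 <;> cases h' : s.coherent (G.next p).1 <;>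
    simp_all [PoleState.step, PoleState.flip, arrivalCrossing, arrival, Dart.rev, other]

theorem PoleState.sign_flip (s : G.PoleState) (e : G.Dart) : s.sign (s.flip e) = s.sign e := by
  obtain ⟨p, b⟩ := e
  cases b <;> cases h : s.coherent p.1 <;> cases h' : s.coherent (G.next p).1 <;>
    simp_all [PoleState.step, PoleState.flip, PoleState.sign, arrivalCrossing, arrival, Dart.rev,
      other]

/-- Poles sit exactly where the travel switches between following and opposing the orientation of
the link. The sign is thus a difference that telescopes along a pole curve. -/
theorem PoleState.two_mul_sign (s : G.PoleState) (e : G.Dart) :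
    2 * s.sign e = cond e.2 1 (-1) - cond (s.step e).2 1 (-1) := by
  obtain ⟨p, b⟩ := e
  cases b <;> cases h : s.coherent p.1 <;> cases h' : s.coherent (G.next p).1 <;>
    simp_all [PoleState.step, PoleState.sign, arrivalCrossing, arrival]

/-- The signed count of poles vanishes on each pole curve, hence so does its sum weighted by a
function which is constant on pole curves. -/
theorem PoleState.sum_mul_sign_of_step (s : G.PoleState) (χ : G.Dart → ℤ)
    (h : ∀ e, χ (s.step e) = χ e) : ∑ e, χ e * s.sign e = 0 := by
  have h1 : ∑ e : G.Dart, χ (s.step e) * (cond (s.step e).2 1 (-1) : ℤ) =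
      ∑ e : G.Dart, χ e * (cond e.2 1 (-1) : ℤ) :=
    Equiv.sum_comp (Equiv.ofBijective s.step (Finite.injective_iff_bijective.mp s.step_injective))
      fun e : G.Dart => χ e * (cond e.2 1 (-1) : ℤ)
  have h2 : 2 * ∑ e, χ e * s.sign e = 0 := by
    rw [Finset.mul_sum, ← sub_eq_zero.mpr h1.symm, ← Finset.sum_sub_distrib]
    refine Finset.sum_congr rfl fun e _ => ?_
    rw [h, mul_left_comm, s.two_mul_sign]
    ring
  omega

/-- The signed count of poles vanishes at each crossing. -/
theorem PoleState.sum_mul_sign_of_crossing (s : G.PoleState) (χ : G.Crossing → ℤ) :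
    ∑ e : G.Dart, χ (arrivalCrossing e) * s.sign e = 0 := by
  rw [Fintype.sum_prod_type]
  simp only [Fintype.sum_bool]
  rw [Finset.sum_add_distrib]
  -- The two darts that reach the plaque along the strand `next p`, one from each end, have opposite
  -- signs; reindexing by `next` pairs them.
  have h1 : ∑ p : G.Passage, χ (arrivalCrossing (G.next p, false)) *
      s.sign (G.next p, false) = ∑ p : G.Passage, χ (arrivalCrossing (p, false)) *
      s.sign (p, false) := Equiv.sum_comp G.next fun p =>
        χ (arrivalCrossing (p, false)) * s.sign (p, false)
  rw [← h1, ← Finset.sum_add_distrib]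
  refine Finset.sum_eq_zero fun p _ => ?_
  simp only [arrivalCrossing, arrival, PoleState.sign]
  cases s.coherent (G.next p).1 <;> simp

/-! ## The darts on a pole curve -/

open Classical in
/-- The darts on the pole curve through `e`, in the direction of `e`. -/
noncomputable def PoleState.orbit (s : G.PoleState) (e : G.Dart) : Finset G.Dart :=
  (Finset.range (Function.minimalPeriod s.step e)).image fun n => s.step^[n] e

theorem PoleState.isPeriodicPt (s : G.PoleState) (e : G.Dart) :
    e ∈ Function.periodicPts s.step :=
  s.step_injective.mem_periodicPts e

theorem PoleState.minimalPeriod_pos (s : G.PoleState) (e : G.Dart) :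
    0 < Function.minimalPeriod s.step e :=
  Function.minimalPeriod_pos_of_mem_periodicPts (s.isPeriodicPt e)

theorem PoleState.mem_orbit {s : G.PoleState} {e e' : G.Dart} :
    e' ∈ s.orbit e ↔ ∃ n, s.step^[n] e = e' := by
  simp only [PoleState.orbit, Finset.mem_image, Finset.mem_range]
  constructor
  · rintro ⟨n, -, h⟩
    exact ⟨n, h⟩
  · rintro ⟨n, h⟩
    exact ⟨_, Nat.mod_lt n (s.minimalPeriod_pos e), by
      rw [Function.iterate_mod_minimalPeriod_eq, h]⟩

theorem PoleState.step_mem_orbit {s : G.PoleState} {e e' : G.Dart} :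
    s.step e' ∈ s.orbit e ↔ e' ∈ s.orbit e := by
  constructor
  · rw [mem_orbit, mem_orbit]
    rintro ⟨n, h⟩
    have hN := s.minimalPeriod_pos e
    -- The predecessor is reached by going round once less one step, which also covers `n = 0`.
    refine ⟨n + (Function.minimalPeriod s.step e - 1), s.step_injective ?_⟩
    rw [← Function.iterate_succ_apply' s.step, ← h, Nat.succ_eq_add_one, add_assoc,
      Nat.sub_add_cancel hN, Function.iterate_add_apply, Function.iterate_minimalPeriod]
  · rw [mem_orbit, mem_orbit]
    rintro ⟨n, h⟩
    exact ⟨n + 1, by rw [Function.iterate_succ_apply', h]⟩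

theorem PoleState.orbit_induction {s : G.PoleState} {e : G.Dart} {P : G.Dart → Prop} (h0 : P e)
    (h : ∀ e' ∈ s.orbit e, P e' → P (s.step e')) : ∀ e' ∈ s.orbit e, P e' := by
  intro e' he'
  obtain ⟨n, rfl⟩ := mem_orbit.mp he'
  clear he'
  induction n with
  | zero => exact h0
  | succ n ih =>
    rw [Function.iterate_succ_apply']
    exact h _ (mem_orbit.mpr ⟨n, rfl⟩) ih

theorem PoleState.flip_mem_orbit {s : G.PoleState} {e e' : G.Dart} :
    s.flip e' ∈ s.orbit e ↔ Dart.rev e' ∈ s.orbit e := by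
  rw [← step_mem_orbit, step_flip]

theorem PoleState.flip_step_mem_orbit {s : G.PoleState} {e e' : G.Dart} :
    s.flip (s.step e') ∈ s.orbit e ↔ s.flip e' ∈ s.orbit e := by
  rw [← step_mem_orbit, flip_step]

/-- The weighted count of the poles on a pole curve, from a function on the crossings which is
constant along each other pole curve. -/
theorem PoleState.sum_orbit_eq_zero (s : G.PoleState) (e₀ : G.Dart) (χ : G.Crossing → ℤ)
    (κ : G.Dart → ℤ)
    (hκ : ∀ e, e ∉ s.orbit e₀ → s.flip e ∉ s.orbit e₀ →
      κ (s.step e) = κ e ∧ χ (arrivalCrossing e) = κ e) :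
    ∑ e ∈ s.orbit e₀, χ (arrivalCrossing e) * s.sign e = 0 := by
  classical
  set g : G.Dart → ℤ := fun e => χ (arrivalCrossing e) * s.sign e with hg
  set O := s.orbit e₀ with hO
  have gflip : ∀ e, g (s.flip e) = g e := fun e => by
    simp only [hg, s.arrivalCrossing_flip, s.sign_flip]
  -- Each curve is counted in both directions of travel; reversal preserves the crossing and the
  -- sign of every pole.
  have hflip : ∑ e, (if s.flip e ∈ O then g e else 0) = ∑ e, if e ∈ O then g e else 0 := by
    have := Equiv.sum_comp (⟨s.flip, s.flip, s.flip_flip, s.flip_flip⟩ : G.Dart ≃ G.Dart)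
      fun e => if e ∈ O then g e else 0
    simpa [gflip] using this
  have hoff : ∑ e, (if e ∈ O ∨ s.flip e ∈ O then 0 else g e) = 0 := by
    refine Eq.trans ?_
      (s.sum_mul_sign_of_step (fun e => if e ∈ O ∨ s.flip e ∈ O then 0 else κ e) ?_)
    · refine Finset.sum_congr rfl fun e _ => ?_
      split_ifs with h
      · simp
      · push Not at h
        simp only [hg, (hκ e h.1 h.2).2]
    · intro e
      simp only [hO, step_mem_orbit, flip_step_mem_orbit]
      split_ifs with h
      · rfl
      · push Not at h
        exact (hκ e h.1 h.2).1
  have hall : ∑ e, g e = 0 := s.sum_mul_sign_of_crossing χ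
  have hsub : ∑ e ∈ O, g e = ∑ e, if e ∈ O then g e else 0 := by
    rw [Finset.sum_ite_mem, Finset.univ_inter]
  rw [hsub]
  -- If the orbit contained one arc in both directions it would be invariant under `flip`, and the
  -- total would be the part off the curve plus a single copy of the sum. Treating this case makes
  -- it unnecessary to exclude it. Otherwise two equal copies appear.
  by_cases hd : ∃ e ∈ O, s.flip e ∈ O
  · obtain ⟨e, he, hfe⟩ := hd
    have hback : ∀ n, ∀ e', s.step^[n] e₀ = e' → (s.flip e' ∈ O ↔ s.flip e₀ ∈ O) := by
      intro n
      induction n with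
      | zero => rintro e' rfl; rfl
      | succ n ih =>
        rintro e' rfl
        rw [Function.iterate_succ_apply', hO, flip_step_mem_orbit]
        exact ih _ rfl
    have h0 : s.flip e₀ ∈ O := by
      obtain ⟨n, hn⟩ := mem_orbit.mp he
      exact (hback n e hn).mp hfe
    have hall_flip : ∀ e ∈ O, s.flip e ∈ O := fun e he => by
      obtain ⟨n, hn⟩ := mem_orbit.mp he
      exact (hback n e hn).mpr h0
    have : ∀ e, (e ∈ O ∨ s.flip e ∈ O) ↔ e ∈ O := fun e =>
      ⟨fun h => h.elim id fun h => by simpa [s.flip_flip] using hall_flip _ h, Or.inl⟩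
    simp only [this] at hoff
    have hsplit : ∑ e, g e = ∑ e, (if e ∈ O then 0 else g e) + ∑ e, if e ∈ O then g e else 0 := by
      rw [← Finset.sum_add_distrib]
      refine Finset.sum_congr rfl fun e _ => ?_
      split_ifs <;> simp
    omega
  · push Not at hd
    have : ∑ e, g e = ∑ e, (if e ∈ O ∨ s.flip e ∈ O then 0 else g e) +
        (∑ e, (if e ∈ O then g e else 0) + ∑ e, if s.flip e ∈ O then g e else 0) := by
      rw [← Finset.sum_add_distrib, ← Finset.sum_add_distrib]
      refine Finset.sum_congr rfl fun e _ => ?_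
      by_cases h1 : e ∈ O
      · simp [h1, hd e h1]
      · by_cases h2 : s.flip e ∈ O <;> simp [h1, h2]
    omega

/-! ## The poles on a pole curve -/

/-- The poles met along `n` consecutive darts. -/
def PoleState.poleList (s : G.PoleState) (e : G.Dart) (n : ℕ) : List Pole :=
  (List.range n).filterMap fun n => s.pole? (s.step^[n] e)

/-- The Boolean of a dart changes precisely at a pole, and its value before the change determines
the kind. -/
theorem PoleState.alternatingPoles (s : G.PoleState) (e : G.Dart) (n : ℕ) :
    AlternatingPoles e.2 (s.poleList e n) (s.step^[n] e).2 := by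
  induction n with
  | zero => rfl
  | succ n ih =>
    simp only [PoleState.poleList, List.range_succ, List.filterMap_append]
    refine alternatingPoles_append.mpr ⟨_, ih, ?_⟩
    rw [Function.iterate_succ_apply', List.filterMap_cons, List.filterMap_nil]
    generalize s.step^[n] e = e'
    obtain ⟨p, b⟩ := e'
    cases b <;> cases h : s.coherent p.1 <;> cases h' : s.coherent (G.next p).1 <;>
      simp_all [PoleState.step, arrival, PoleState.pole?, AlternatingPoles]

/-- The weight of the pole in the plaque of arrival, zero if there is none. -/
def PoleState.weight (s : G.PoleState) (a b : ℤ) (e : G.Dart) : ℤ :=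
  (s.pole? e).elim 0 (Pole.weight a b)

theorem PoleState.sum_poleList (s : G.PoleState) (e : G.Dart) (a b : ℤ) (n : ℕ) :
    ((s.poleList e n).map (Pole.weight a b)).sum =
      ∑ i ∈ Finset.range n, s.weight a b (s.step^[i] e) := by
  induction n with
  | zero => rfl
  | succ n ih =>
    rw [Finset.sum_range_succ, ← ih]
    simp only [PoleState.poleList, List.range_succ, List.filterMap_append, List.map_append,
      List.sum_append, PoleState.weight]
    cases h : s.pole? (s.step^[n] e) <;> simp [h]

theorem PoleState.weight_eq (s : G.PoleState) (a b : ℤ) (e : G.Dart) :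
    s.weight a b e = (if G.horizontal (arrival e) then a else b) * s.sign e := by
  obtain ⟨p, c⟩ := e
  cases c <;> cases h : s.coherent p.1 <;> cases h' : s.coherent (G.next p).1 <;>
    simp_all [PoleState.weight, PoleState.pole?, arrival, PoleState.sign, arrivalCrossing] <;>
    split_ifs <;> simp_all [Pole.weight]

theorem PoleState.sum_orbit (s : G.PoleState) (e : G.Dart) (g : G.Dart → ℤ) :
    ∑ e' ∈ s.orbit e, g e' =
      ∑ i ∈ Finset.range (Function.minimalPeriod s.step e), g (s.step^[i] e) := by
  classical
  rw [PoleState.orbit, Finset.sum_image]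
  intro i hi j hj h
  exact Function.iterate_injOn_Iio_minimalPeriod (by simpa using hi) (by simpa using hj) h

/-- A pole curve has index zero if the weighted count of its poles vanishes for weights that
distinguish its sides. -/
theorem PoleState.index_eq_zero (s : G.PoleState) (e : G.Dart) {k : ℕ}
    (hk : HasIndex (PoleCurve.through (s := s) e).poles k) {a b : ℤ} (hab : a ≠ b)
    (h : ∑ e' ∈ s.orbit e, (if G.horizontal (arrival e') then a else b) * s.sign e' = 0) :
    k = 0 := by
  have hN : s.step^[Function.minimalPeriod s.step e] e = e := Function.iterate_minimalPeriod
  have halt := s.alternatingPoles e (Function.minimalPeriod s.step e)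
  rw [hN] at halt
  refine HasIndex.eq_zero (w := s.poleList e (Function.minimalPeriod s.step e)) hk halt hab ?_ ?_
  · rw [s.sum_poleList, ← s.sum_orbit e fun e' => s.weight a b e', ← h]
    exact Finset.sum_congr rfl fun e' _ => s.weight_eq a b e'
  · rw [s.sum_poleList]
    -- With equal weights on both sides the sum telescopes, and it closes up after a full period.
    have : ∀ n, 2 * ∑ i ∈ Finset.range n, s.weight 1 1 (s.step^[i] e) =
        cond e.2 1 (-1) - cond (s.step^[n] e).2 1 (-1) := by
      intro n
      induction n with
      | zero => simp
      | succ n ih =>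
        rw [Finset.sum_range_succ, mul_add, ih, Function.iterate_succ_apply', s.weight_eq, ite_self,
          one_mul, s.two_mul_sign]
        ring
    have h2 := this (Function.minimalPeriod s.step e)
    rw [hN, sub_self] at h2
    omega


/-! ## Plaques in the surface -/

/-- The projection of the pieces to the surface. -/
def surfaceMk (x : G.Pieces) : G.Surface := Quot.mk G.Glue x

theorem isQuotientMap_surfaceMk : Topology.IsQuotientMap (surfaceMk (G := G)) :=
  isQuotientMap_quot_mk

/-- The point of the surface given by a point of a plaque. -/
def plaquePoint (c : G.Crossing) (z : Plaque) : G.Surface := surfaceMk (.inl ⟨c, z⟩)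

theorem continuous_plaquePoint (c : G.Crossing) : Continuous (plaquePoint c) :=
  isQuotientMap_surfaceMk.continuous.comp (continuous_inl.comp continuous_sigmaMk)

theorem horizontal_other (p : G.Passage) : G.horizontal (other p) = !G.horizontal p := by
  simp only [horizontal, other]
  cases p.2 <;> cases G.positive p.1 <;> rfl

/-- The signed height of a point of the plaque at which `e` arrives over the arc of the pole curve,
positive on the left of the arc. -/
def PoleState.height (s : G.PoleState) (e : G.Dart) (z : Plaque) : ℝ :=
  match s.coherent (arrival e).1, e.2, G.horizontal (arrival e) with
  | true, true, true => z.1.2 - z.1.1 - 1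
  | true, true, false => z.1.2 - z.1.1 + 1
  | true, false, true => z.1.1 - z.1.2 - 1
  | true, false, false => z.1.1 - z.1.2 + 1
  | false, true, true => z.1.1 + z.1.2 + 1
  | false, true, false => -(z.1.1 + z.1.2 + 1)
  | false, false, true => 1 - z.1.1 - z.1.2
  | false, false, false => z.1.1 + z.1.2 - 1

theorem PoleState.exists_height_eq (s : G.PoleState) (e : G.Dart) :
    ∃ a b c : ℝ, (a = 1 ∨ a = -1) ∧ (b = 1 ∨ b = -1) ∧ (c = 1 ∨ c = -1) ∧
      ∀ z, s.height e z = a * z.1.1 + b * z.1.2 + c := by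
  unfold PoleState.height
  split
  · exact ⟨-1, 1, -1, by simp, by simp, by simp, fun z => by ring⟩
  · exact ⟨-1, 1, 1, by simp, by simp, by simp, fun z => by ring⟩
  · exact ⟨1, -1, -1, by simp, by simp, by simp, fun z => by ring⟩
  · exact ⟨1, -1, 1, by simp, by simp, by simp, fun z => by ring⟩
  · exact ⟨1, 1, 1, by simp, by simp, by simp, fun z => by ring⟩
  · exact ⟨-1, -1, -1, by simp, by simp, by simp, fun z => by ring⟩
  · exact ⟨-1, -1, 1, by simp, by simp, by simp, fun z => by ring⟩
  · exact ⟨1, 1, -1, by simp, by simp, by simp, fun z => by ring⟩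

theorem PoleState.continuous_height (s : G.PoleState) (e : G.Dart) : Continuous (s.height e) := by
  obtain ⟨a, b, c, -, -, -, h⟩ := s.exists_height_eq e
  rw [show s.height e = _ from funext h]
  fun_prop

theorem PoleState.mem_plaqueArc {s : G.PoleState} {e : G.Dart} {z : Plaque} :
    z ∈ s.plaqueArc e ↔ s.height e z = 0 := by
  obtain ⟨p, b⟩ := e
  cases b <;> cases h : s.coherent p.1 <;> cases h' : s.coherent (G.next p).1 <;>
    cases h1 : G.horizontal p <;> cases h2 : G.horizontal (G.next p) <;>
    simp only [PoleState.plaqueArc, PoleState.height, arrival, h, h', h1, h2, Set.mem_ofPred_eq,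
      if_true, if_false, Bool.false_eq_true] <;>
    constructor <;> intro <;> linarith

/-- The center of the plaque, where the two strands cross. -/
def Plaque.center : Plaque := ⟨0, by simp⟩

theorem PoleState.height_center (s : G.PoleState) (e : G.Dart) :
    |s.height e Plaque.center| = 1 := by
  obtain ⟨a, b, c, -, -, hc, h⟩ := s.exists_height_eq e
  rw [h]
  rcases hc with rfl | rfl <;> simp [Plaque.center]

/-- This expresses that a pole faces the crossing point: by `weight_eq`, `horizontal` also decides
whether the pole is on the left. -/
theorem PoleState.height_center_of_sign_ne_zero (s : G.PoleState) (e : G.Dart)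
    (h : s.sign e ≠ 0) :
    s.height e Plaque.center = if G.horizontal (arrival e) then 1 else -1 := by
  have hc : s.coherent (arrival e).1 = false := by
    cases hc : s.coherent (arrival e).1
    · rfl
    · simp [PoleState.sign, arrivalCrossing, hc] at h
  cases hb : e.2 <;> cases hh : G.horizontal (arrival e) <;>
    simp [PoleState.height, hc, hb, hh, Plaque.center]

theorem PoleState.height_flip (s : G.PoleState) (e : G.Dart) (z : Plaque) :
    s.height (s.flip e) z = - s.height e z := by
  obtain ⟨p, b⟩ := e
  have ho' : ∀ q : G.Passage, (other q).1 = q.1 := fun q => rfl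
  cases b <;> cases h : s.coherent p.1 <;> cases h' : s.coherent (G.next p).1 <;>
    cases h1 : G.horizontal p <;> cases h2 : G.horizontal (G.next p) <;>
    simp [PoleState.height, PoleState.flip, PoleState.step, Dart.rev, arrival, h, h', h1, h2,
      horizontal_other, ho'] <;> ring

theorem eq_or_eq_other {p q : G.Passage} (h : p.1 = q.1) : p = q ∨ p = other q := by
  obtain ⟨c, b⟩ := p
  obtain ⟨c', b'⟩ := q
  obtain rfl : c = c' := h
  cases b <;> cases b' <;> simp [other]

theorem dart_eq {e e' : G.Dart} (h : arrival e = arrival e') (h' : e.2 = e'.2) : e = e' := by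
  obtain ⟨p, b⟩ := e
  obtain ⟨q, b'⟩ := e'
  obtain rfl : b = b' := h'
  cases b <;> simp_all [arrival]

/-- Two arcs in the same plaque either coincide or are disjoint and parallel. -/
theorem PoleState.height_of_arrivalCrossing_eq {s : G.PoleState} {e e' : G.Dart}
    (h : arrivalCrossing e' = arrivalCrossing e) :
    e' = e ∨ e' = s.flip e ∨ ∀ z, s.height e' z = 0 → |s.height e z| = 2 := by
  have hf : arrival (s.flip e) = other (arrival e) := by
    obtain ⟨p, b⟩ := e
    cases b <;> cases h : s.coherent p.1 <;> cases h' : s.coherent (G.next p).1 <;>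
      simp [PoleState.flip, PoleState.step, Dart.rev, arrival, h, h']
  have hf2 : (s.flip e).2 = if s.coherent (arrivalCrossing e) then !e.2 else e.2 := by
    obtain ⟨p, b⟩ := e
    cases b <;> cases h : s.coherent p.1 <;> cases h' : s.coherent (G.next p).1 <;>
      simp [PoleState.flip, PoleState.step, Dart.rev, arrival, arrivalCrossing, h, h']
  have hc' : s.coherent (arrival e').1 = s.coherent (arrival e).1 := congrArg s.coherent h
  have habs : ∀ {x : ℝ}, x = 2 ∨ x = -2 → |x| = 2 := by rintro x (rfl | rfl) <;> norm_num
  rcases eq_or_eq_other (p := arrival e') (q := arrival e) h with ha | ha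
  · by_cases hb : e'.2 = e.2
    · exact .inl (dart_eq ha hb)
    · refine .inr (.inr fun z hz => habs ?_)
      cases hc : s.coherent (arrival e).1 <;> cases h1 : e.2 <;> cases h2 : e'.2 <;>
        cases h3 : G.horizontal (arrival e) <;>
        simp_all [PoleState.height] <;>
        first | (left; linarith) | (right; linarith)
  · have ho : G.horizontal (arrival e') = !G.horizontal (arrival e) := by
      rw [ha, horizontal_other]
    by_cases hb : e'.2 = (s.flip e).2
    · exact .inr (.inl (dart_eq (ha.trans hf.symm) hb))
    · refine .inr (.inr fun z hz => habs ?_)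
      clear ha hf h
      cases hc : s.coherent (arrival e).1 <;> cases h1 : e.2 <;> cases h2 : e'.2 <;>
        cases h3 : G.horizontal (arrival e) <;>
        simp_all [PoleState.height, arrivalCrossing] <;>
        first | (left; linarith) | (right; linarith)

/-! ## Entering and leaving a plaque -/

/-- The opposite offset. -/
def offsetNeg (t : Set.Ioo (-1 : ℝ) 1) : Set.Ioo (-1 : ℝ) 1 :=
  ⟨-t, by linarith [t.2.2], by linarith [t.2.1]⟩

/-- The point where `e`, displaced by `t` to its left, enters the plaque of arrival. -/
def entryPoint (e : G.Dart) (t : Set.Ioo (-1 : ℝ) 1) : Plaque :=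
  match e with
  | (p, true) => G.inSide (G.next p) t
  | (p, false) => G.outSide p (offsetNeg t)

/-- The passage at whose end a dart departs. -/
def departure : G.Dart → G.Passage
  | (p, true) => p
  | (p, false) => G.next p

/-- The point where `e`, displaced by `t` to its left, leaves the plaque of departure. -/
def exitPoint (e : G.Dart) (t : Set.Ioo (-1 : ℝ) 1) : Plaque :=
  match e with
  | (p, true) => G.outSide p t
  | (p, false) => G.inSide (G.next p) (offsetNeg t)

theorem plaquePoint_exitPoint (e : G.Dart) (t : Set.Ioo (-1 : ℝ) 1) :
    plaquePoint (departure e).1 (exitPoint e t) = plaquePoint (arrivalCrossing e) (entryPoint e t) := by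
  obtain ⟨p, b⟩ := e
  cases b
  · exact (Quot.sound (Glue.arc p (offsetNeg t))).symm
  · exact Quot.sound (Glue.arc p t)

theorem PoleState.departure_step (s : G.PoleState) (e : G.Dart) :
    (departure (s.step e)).1 = arrivalCrossing e := by
  obtain ⟨p, b⟩ := e
  cases b <;> cases h : s.coherent p.1 <;> cases h' : s.coherent (G.next p).1 <;>
    simp [PoleState.step, departure, arrivalCrossing, arrival, other, h, h']

/-- The height is normalized to equal the left offset at both ends of an arc. As the gluing
preserves offsets, the sides match from plaque to plaque. -/
theorem PoleState.height_entryPoint (s : G.PoleState) (e : G.Dart) (t : Set.Ioo (-1 : ℝ) 1) :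
    s.height e (entryPoint e t) = t := by
  obtain ⟨p, b⟩ := e
  cases b <;> cases h : s.coherent p.1 <;> cases h' : s.coherent (G.next p).1 <;>
    cases h1 : G.horizontal p <;> cases h2 : G.horizontal (G.next p) <;>
    simp [PoleState.height, entryPoint, inSide, outSide, offsetNeg, arrival, h, h', h1, h2]

theorem PoleState.height_exitPoint (s : G.PoleState) (e : G.Dart) (t : Set.Ioo (-1 : ℝ) 1) :
    s.height e (exitPoint (s.step e) t) = t := by
  obtain ⟨p, b⟩ := e
  cases b <;> cases h : s.coherent p.1 <;> cases h' : s.coherent (G.next p).1 <;>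
    cases h1 : G.horizontal p <;> cases h2 : G.horizontal (G.next p) <;>
    simp [PoleState.height, PoleState.step, exitPoint, inSide, outSide, offsetNeg, arrival, h, h',
      h1, h2, horizontal_other]

/-! ## The carrier of a pole curve in the plaques -/

/-- The other arc in the plaque lies at height `2` or `-2`, outside the strip considered here. -/
theorem PoleState.exists_mem_orbit_height_iff {s : G.PoleState} {e₀ e : G.Dart} {z : Plaque}
    (hz : |s.height e z| < 2) :
    (∃ e' ∈ s.orbit e₀, arrivalCrossing e' = arrivalCrossing e ∧ s.height e' z = 0) ↔
      s.height e z = 0 ∧ (e ∈ s.orbit e₀ ∨ s.flip e ∈ s.orbit e₀) := by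
  constructor
  · rintro ⟨e', he', hc, h0⟩
    rcases s.height_of_arrivalCrossing_eq hc with rfl | rfl | h
    · exact ⟨h0, .inl he'⟩
    · exact ⟨by rwa [s.height_flip, neg_eq_zero] at h0, .inr he'⟩
    · exact absurd (h z h0) hz.ne
  · rintro ⟨h0, h | h⟩
    · exact ⟨e, h, rfl, h0⟩
    · exact ⟨_, h, s.arrivalCrossing_flip e, by rw [s.height_flip, h0, neg_zero]⟩

theorem PoleState.exists_mem_orbit_entryPoint_iff {s : G.PoleState} {e₀ e : G.Dart}
    {t : Set.Ioo (-1 : ℝ) 1} :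
    (∃ e' ∈ s.orbit e₀, arrivalCrossing e' = arrivalCrossing e ∧
      s.height e' (entryPoint e t) = 0) ↔
      (t : ℝ) = 0 ∧ (e ∈ s.orbit e₀ ∨ Dart.rev e ∈ s.orbit e₀) := by
  have h : |(t : ℝ)| < 1 := abs_lt.mpr t.2
  rw [exists_mem_orbit_height_iff, s.height_entryPoint, flip_mem_orbit]
  rw [s.height_entryPoint]
  linarith

variable (s : G.PoleState) (e₀ : G.Dart)

/-- Stated as an equality of propositions so that the membership criterion descends through
`Quot.lift`. -/
theorem PoleState.carrier_saturated {a b : G.Pieces} (h : G.Glue a b) :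
    (∃ c z, a = .inl ⟨c, z⟩ ∧ ∃ e ∈ s.orbit e₀, arrivalCrossing e = c ∧ s.height e z = 0) =
      ∃ c z, b = .inl ⟨c, z⟩ ∧ ∃ e ∈ s.orbit e₀, arrivalCrossing e = c ∧ s.height e z = 0 := by
  obtain ⟨p, t⟩ := h
  have h1 := s.exists_mem_orbit_entryPoint_iff (e₀ := e₀) (e := (p, true)) (t := t)
  have h2 := s.exists_mem_orbit_entryPoint_iff (e₀ := e₀) (e := (p, false)) (t := offsetNeg t)
  have ht : offsetNeg (offsetNeg t) = t := by simp [offsetNeg]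
  simp only [entryPoint, Dart.rev, Bool.not_true, Bool.not_false, ht] at h1 h2
  have key : ∀ (c : G.Crossing) (z : Plaque), (∃ c' z', (Sum.inl ⟨c, z⟩ : G.Pieces) =
      .inl ⟨c', z'⟩ ∧ ∃ e ∈ s.orbit e₀, arrivalCrossing e = c' ∧ s.height e z' = 0) ↔
      ∃ e ∈ s.orbit e₀, arrivalCrossing e = c ∧ s.height e z = 0 := by
    intro c z
    constructor
    · rintro ⟨c', z', h, h'⟩
      cases h
      exact h'
    · exact fun h => ⟨c, z, rfl, h⟩
  rw [key, key]
  refine propext (h2.trans (Iff.trans ?_ h1.symm))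
  simp only [offsetNeg, neg_eq_zero]
  tauto

theorem PoleState.mem_carrier_iff (x : G.Pieces) :
    (surfaceMk x ∈ (PoleCurve.through (s := s) e₀).carrier) ↔
      ∃ c z, x = .inl ⟨c, z⟩ ∧ ∃ e ∈ s.orbit e₀, arrivalCrossing e = c ∧ s.height e z = 0 := by
  constructor
  · intro h
    obtain ⟨n, z, hz, hx⟩ := Set.mem_iUnion.mp h
    have := congrArg (Quot.lift _ fun a b => s.carrier_saturated e₀ (a := a) (b := b)) hx
    simp only [surfaceMk] at this
    rw [← this]
    exact ⟨_, z, rfl, _, mem_orbit.mpr ⟨n, rfl⟩, rfl, mem_plaqueArc.mp hz⟩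
  · rintro ⟨c, z, rfl, e, he, rfl, h0⟩
    obtain ⟨n, rfl⟩ := mem_orbit.mp he
    exact Set.mem_iUnion.mpr ⟨n, z, mem_plaqueArc.mpr h0, rfl⟩

theorem PoleState.plaquePoint_mem_carrier_iff (c : G.Crossing) (z : Plaque) :
    plaquePoint c z ∈ (PoleCurve.through (s := s) e₀).carrier ↔
      ∃ e ∈ s.orbit e₀, arrivalCrossing e = c ∧ s.height e z = 0 := by
  rw [plaquePoint, s.mem_carrier_iff]
  constructor
  · rintro ⟨c', z', h, h'⟩
    cases h
    exact h'
  · exact fun h => ⟨c, z, rfl, h⟩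

theorem PoleState.isCompact_height_eq_zero (e : G.Dart) : IsCompact {z | s.height e z = 0} := by
  obtain ⟨a, b, c, ha, hb, hc, h⟩ := s.exists_height_eq e
  rw [Topology.IsEmbedding.subtypeVal.isCompact_iff]
  have : Subtype.val '' {z : Plaque | s.height e z = 0} =
      Set.Icc (-1 : ℝ × ℝ) 1 ∩ {z | a * z.1 + b * z.2 + c = 0} := by
    ext ⟨x, y⟩
    simp only [Set.mem_image, Set.mem_ofPred_eq, h, Subtype.exists, exists_and_left, Set.mem_inter_iff,
      Set.mem_Icc, Prod.le_def, Prod.fst_neg, Prod.snd_neg, Prod.fst_one, Prod.snd_one]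
    constructor
    · rintro ⟨z, hz, ⟨h1, h2, -⟩, rfl⟩
      rw [abs_le] at h1 h2
      exact ⟨⟨⟨h1.1, h2.1⟩, h1.2, h2.2⟩, hz⟩
    · rintro ⟨⟨⟨h1, h2⟩, h3, h4⟩, h0⟩
      refine ⟨(x, y), h0, ⟨abs_le.mpr ⟨h1, h3⟩, abs_le.mpr ⟨h2, h4⟩, ?_⟩, rfl⟩
      rw [abs_lt, abs_lt]
      by_contra hcon
      -- Only the removed corners could violate compactness. There the affine height is a sum of
      -- three terms `±1`, hence odd and nonzero.
      have hx : x = 1 ∨ x = -1 := by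
        by_contra hx
        push Not at hx
        exact hcon (.inl ⟨lt_of_le_of_ne h1 hx.2.symm, lt_of_le_of_ne h3 hx.1⟩)
      have hy : y = 1 ∨ y = -1 := by
        by_contra hy
        push Not at hy
        exact hcon (.inr ⟨lt_of_le_of_ne h2 hy.2.symm, lt_of_le_of_ne h4 hy.1⟩)
      rcases ha with rfl | rfl <;> rcases hb with rfl | rfl <;> rcases hc with rfl | rfl <;>
        rcases hx with rfl | rfl <;> rcases hy with rfl | rfl <;> norm_num at h0
  rw [this]
  refine isCompact_Icc.inter_right (isClosed_eq ?_ continuous_const)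
  fun_prop

theorem PoleState.isCompact_carrier : IsCompact (PoleCurve.through (s := s) e₀).carrier := by
  have : (PoleCurve.through (s := s) e₀).carrier =
      ⋃ e ∈ s.orbit e₀, plaquePoint (arrivalCrossing e) '' {z | s.height e z = 0} := by
    ext x
    obtain ⟨x, rfl⟩ := isQuotientMap_surfaceMk.surjective x
    rw [s.mem_carrier_iff]
    simp only [Set.mem_iUnion, Set.mem_image, Set.mem_ofPred_eq]
    constructor
    · rintro ⟨c, z, rfl, e, he, rfl, h0⟩
      exact ⟨e, he, z, h0, rfl⟩
    · rintro ⟨e, he, z, h0, hx⟩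
      rw [← s.mem_carrier_iff, ← hx, plaquePoint_mem_carrier_iff]
      exact ⟨e, he, rfl, h0⟩
  rw [this]
  exact (s.orbit e₀).finite_toSet.isCompact_biUnion fun e _ =>
    (s.isCompact_height_eq_zero e).image (continuous_plaquePoint _)

theorem convex_plaque : Convex ℝ {z : ℝ × ℝ | |z.1| ≤ 1 ∧ |z.2| ≤ 1 ∧ (|z.1| < 1 ∨ |z.2| < 1)} := by
  have hle : ∀ {p q x y : ℝ}, 0 ≤ p → 0 ≤ q → p + q = 1 → |x| ≤ 1 → |y| ≤ 1 →
      |p * x + q * y| ≤ 1 := fun hp hq h hx hy => by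
    refine (abs_add_le _ _).trans ?_
    rw [abs_mul, abs_mul, abs_of_nonneg hp, abs_of_nonneg hq]
    nlinarith
  have hlt : ∀ {p q x y : ℝ}, 0 < p → 0 ≤ q → p + q = 1 → |x| < 1 → |y| ≤ 1 →
      |p * x + q * y| < 1 := fun hp hq h hx hy => by
    refine (abs_add_le _ _).trans_lt ?_
    rw [abs_mul, abs_mul, abs_of_pos hp, abs_of_nonneg hq]
    nlinarith
  rintro z ⟨h1, h2, h3⟩ w ⟨h4, h5, h6⟩ p q hp hq hpq
  rcases hp.eq_or_lt with rfl | hp'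
  · obtain rfl : q = 1 := by linarith
    simpa using ⟨h4, h5, h6⟩
  · exact ⟨hle hp hq hpq h1 h4, hle hp hq hpq h2 h5,
      h3.imp (fun h => hlt hp' hq hpq h h4) fun h => hlt hp' hq hpq h h5⟩

theorem PoleState.isPreconnected_height_mem_Ioo (e : G.Dart) (u v : ℝ) :
    IsPreconnected {z | s.height e z ∈ Set.Ioo u v} := by
  obtain ⟨a, b, c, -, -, -, h⟩ := s.exists_height_eq e
  have hind : Topology.IsInducing (Subtype.val : Plaque → ℝ × ℝ) := ⟨rfl⟩
  rw [← hind.isPreconnected_image]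
  have : Subtype.val '' {z : Plaque | s.height e z ∈ Set.Ioo u v} =
      {z : ℝ × ℝ | |z.1| ≤ 1 ∧ |z.2| ≤ 1 ∧ (|z.1| < 1 ∨ |z.2| < 1)} ∩
        {z | a * z.1 + b * z.2 + c ∈ Set.Ioo u v} := by
    ext z
    simp only [Set.mem_image, Set.mem_ofPred_eq, h, Subtype.exists, exists_and_left,
      Set.mem_inter_iff]
    constructor
    · rintro ⟨z, hz, h', rfl⟩
      exact ⟨h', hz⟩
    · exact fun ⟨h', hz⟩ => ⟨z, hz, h', rfl⟩
  rw [this]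
  refine (convex_plaque.inter ?_).isPreconnected
  rintro z ⟨h1, h2⟩ w ⟨h3, h4⟩ p q hp hq hpq
  have e1 : a * (p • z + q • w).1 + b * (p • z + q • w).2 + c =
      p * (a * z.1 + b * z.2 + c) + q * (a * w.1 + b * w.2 + c) := by
    obtain rfl : q = 1 - p := by linarith
    simp
    ring
  rw [Set.mem_ofPred_eq, e1]
  exact convex_Ioo u v ⟨h1, h2⟩ ⟨h3, h4⟩ hp hq hpq


/-! ## The two sides of a pole curve -/

theorem PoleState.notMem_carrier_of_mem_orbit {e : G.Dart} {z : Plaque}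
    (hz : |s.height e z| < 2) (h0 : s.height e z ≠ 0) :
    plaquePoint (arrivalCrossing e) z ∉ (PoleCurve.through (s := s) e₀).carrier := by
  rw [s.plaquePoint_mem_carrier_iff, s.exists_mem_orbit_height_iff hz]
  exact fun h => h0 h.1

/-- For an arc off the curve the whole strip, including the arc itself and the centre of the plaque,
avoids the carrier. -/
theorem PoleState.notMem_carrier_of_notMem_orbit {e : G.Dart} (he : e ∉ s.orbit e₀)
    (he' : s.flip e ∉ s.orbit e₀) {z : Plaque} (hz : |s.height e z| < 2) :
    plaquePoint (arrivalCrossing e) z ∉ (PoleCurve.through (s := s) e₀).carrier := by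
  rw [s.plaquePoint_mem_carrier_iff, s.exists_mem_orbit_height_iff hz]
  exact fun h => h.2.elim he he'

/-- `X` is a union of connected components of the complement of `l`. -/
def IsComponentUnion {S : Type*} [TopologicalSpace S] (l X : Set S) : Prop :=
  ∀ B, IsPreconnected B → B ⊆ lᶜ → (B ∩ X).Nonempty → B ⊆ X

variable {s e₀} {X : Set G.Surface}

theorem PoleState.mem_iff_of_height {l : Set G.Surface} (hX : IsComponentUnion l X) {e : G.Dart}
    {u v : ℝ}
    (hd : ∀ z, s.height e z ∈ Set.Ioo u v → plaquePoint (arrivalCrossing e) z ∉ l)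
    {z w : Plaque} (hz : s.height e z ∈ Set.Ioo u v) (hw : s.height e w ∈ Set.Ioo u v) :
    plaquePoint (arrivalCrossing e) z ∈ X ↔ plaquePoint (arrivalCrossing e) w ∈ X := by
  have hB := (s.isPreconnected_height_mem_Ioo e u v).image _
    (continuous_plaquePoint (arrivalCrossing e)).continuousOn
  have hl : plaquePoint (arrivalCrossing e) '' {z | s.height e z ∈ Set.Ioo u v} ⊆ lᶜ := by
    rintro _ ⟨z, hz, rfl⟩
    exact hd z hz
  exact ⟨fun h => hX _ hB hl ⟨_, ⟨z, hz, rfl⟩, h⟩ ⟨w, hw, rfl⟩,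
    fun h => hX _ hB hl ⟨_, ⟨w, hw, rfl⟩, h⟩ ⟨z, hz, rfl⟩⟩

theorem PoleState.plaquePoint_exitPoint_step (e : G.Dart) (t : Set.Ioo (-1 : ℝ) 1) :
    plaquePoint (arrivalCrossing (s.step e)) (entryPoint (s.step e) t) =
      plaquePoint (arrivalCrossing e) (exitPoint (s.step e) t) := by
  rw [← plaquePoint_exitPoint, s.departure_step]

/-- All points on the same side of the pole curve are in `X` if one of them is. -/
theorem PoleState.mem_iff_of_mem_orbit
    (hX : IsComponentUnion (PoleCurve.through (s := s) e₀).carrier X) {u v : ℝ}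
    (huv : ∀ h ∈ Set.Ioo u v, |h| < 2 ∧ h ≠ 0) {t : Set.Ioo (-1 : ℝ) 1}
    (ht : (t : ℝ) ∈ Set.Ioo u v) :
    ∀ e ∈ s.orbit e₀, ∀ z, s.height e z ∈ Set.Ioo u v →
      (plaquePoint (arrivalCrossing e) z ∈ X ↔
        plaquePoint (arrivalCrossing e₀) (entryPoint e₀ t) ∈ X) := by
  have hside : ∀ {e z w}, s.height e z ∈ Set.Ioo u v → s.height e w ∈ Set.Ioo u v →
      (plaquePoint (arrivalCrossing e) z ∈ X ↔ plaquePoint (arrivalCrossing e) w ∈ X) :=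
    fun {e} _ _ => mem_iff_of_height hX fun z hz =>
      s.notMem_carrier_of_mem_orbit e₀ (huv _ hz).1 (huv _ hz).2
  have hentry : ∀ e, s.height e (entryPoint e t) ∈ Set.Ioo u v := fun e => by
    rwa [s.height_entryPoint]
  have hexit : ∀ e, s.height e (exitPoint (s.step e) t) ∈ Set.Ioo u v := fun e => by
    rwa [s.height_exitPoint]
  refine orbit_induction (fun z hz => hside hz (hentry _)) fun e _ ih z hz => ?_
  rw [hside hz (hentry _), plaquePoint_exitPoint_step]
  exact ih _ (hexit e)

/-- The offset `1 / 2`. -/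
noncomputable def halfOffset : Set.Ioo (-1 : ℝ) 1 := ⟨1 / 2, by norm_num⟩

theorem PoleState.mem_iff_left
    (hX : IsComponentUnion (PoleCurve.through (s := s) e₀).carrier X) :
    ∀ e ∈ s.orbit e₀, ∀ z, s.height e z ∈ Set.Ioo (0 : ℝ) 2 →
      (plaquePoint (arrivalCrossing e) z ∈ X ↔
        plaquePoint (arrivalCrossing e₀) (entryPoint e₀ halfOffset) ∈ X) :=
  mem_iff_of_mem_orbit hX
    (fun _ h => ⟨abs_lt.mpr ⟨by linarith [h.1], h.2⟩, h.1.ne'⟩) (by norm_num [halfOffset])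

theorem PoleState.mem_iff_right
    (hX : IsComponentUnion (PoleCurve.through (s := s) e₀).carrier X) :
    ∀ e ∈ s.orbit e₀, ∀ z, s.height e z ∈ Set.Ioo (-2 : ℝ) 0 →
      (plaquePoint (arrivalCrossing e) z ∈ X ↔
        plaquePoint (arrivalCrossing e₀) (entryPoint e₀ (offsetNeg halfOffset)) ∈ X) :=
  mem_iff_of_mem_orbit hX
    (fun _ h => ⟨abs_lt.mpr ⟨h.1, by linarith [h.2]⟩, h.2.ne⟩)
    (by norm_num [halfOffset, offsetNeg])

/-- A union of components of the complement of a pole curve of positive index contains either both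
sides of the curve or none. -/
theorem PoleState.left_iff_right
    (hX : IsComponentUnion (PoleCurve.through (s := s) e₀).carrier X) {k : ℕ}
    (hk : HasIndex (PoleCurve.through (s := s) e₀).poles k) (hpos : 0 < k) :
    plaquePoint (arrivalCrossing e₀) (entryPoint e₀ halfOffset) ∈ X ↔
      plaquePoint (arrivalCrossing e₀) (entryPoint e₀ (offsetNeg halfOffset)) ∈ X := by
  classical
  by_contra hne
  let ind : Prop → ℤ := fun P => if P then 1 else 0
  have hind : ∀ {P Q : Prop}, (P ↔ Q) → ind P = ind Q := fun h => by simp only [ind, h]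
  -- Offset `0` gives the points of the other pole curves themselves; their membership in `X` is the
  -- function constant along these curves.
  let zero : Set.Ioo (-1 : ℝ) 1 := ⟨0, by norm_num⟩
  refine hpos.ne' (s.index_eq_zero e₀ hk
    (a := ind (plaquePoint (arrivalCrossing e₀) (entryPoint e₀ halfOffset) ∈ X))
    (b := ind (plaquePoint (arrivalCrossing e₀) (entryPoint e₀ (offsetNeg halfOffset)) ∈ X))
    ?_ ?_)
  · simp only [ind]
    split_ifs <;> simp_all
  · rw [← s.sum_orbit_eq_zero e₀ (fun c => ind (plaquePoint c Plaque.center ∈ X))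
      (fun e => ind (plaquePoint (arrivalCrossing e) (entryPoint e zero) ∈ X))]
    · refine Finset.sum_congr rfl fun e he => ?_
      by_cases h0 : s.sign e = 0
      · rw [h0, mul_zero, mul_zero]
      have hc := s.height_center_of_sign_ne_zero e h0
      congr 1
      split_ifs at hc ⊢
      · exact (hind (mem_iff_left hX e he _ (by rw [hc]; norm_num))).symm
      · exact (hind (mem_iff_right hX e he _ (by rw [hc]; norm_num))).symm
    · intro e he he'
      have key : ∀ {z w}, |s.height e z| < 2 → |s.height e w| < 2 →
          (plaquePoint (arrivalCrossing e) z ∈ X ↔ plaquePoint (arrivalCrossing e) w ∈ X) :=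
        fun hz hw => mem_iff_of_height hX
          (fun z hz => s.notMem_carrier_of_notMem_orbit e₀ he he' (abs_lt.mpr hz))
          (abs_lt.mp hz) (abs_lt.mp hw)
      have h1 : |s.height e (entryPoint e zero)| < 2 := by
        rw [s.height_entryPoint]; norm_num [zero]
      refine ⟨hind ?_, hind (key (by rw [s.height_center]; norm_num) h1)⟩
      rw [plaquePoint_exitPoint_step]
      exact key (by rw [s.height_exitPoint]; norm_num [zero]) h1

/-! ### Passing to the ambient surface: open and closed sets -/

/-- An open set that contains both sides of a pole curve becomes a neighborhood of the curve when
the curve is added. -/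
theorem PoleState.isOpen_union_carrier (hX : IsOpen X)
    (h : ∀ e ∈ s.orbit e₀, ∀ z, |s.height e z| < 2 → s.height e z ≠ 0 →
      plaquePoint (arrivalCrossing e) z ∈ X) :
    IsOpen (X ∪ (PoleCurve.through (s := s) e₀).carrier) := by
  rw [← isQuotientMap_surfaceMk.isOpen_preimage, isOpen_sum_iff]
  constructor
  · rw [isOpen_sigma_iff]
    intro c
    -- Adding the carrier amounts to adding whole open strips, whose points off the arcs are already
    -- in `X`.
    have : Sigma.mk c ⁻¹' (Sum.inl ⁻¹' (surfaceMk ⁻¹'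
        (X ∪ (PoleCurve.through (s := s) e₀).carrier))) = plaquePoint c ⁻¹' X ∪
          ⋃ e ∈ s.orbit e₀, ⋃ _ : arrivalCrossing e = c, {z | |s.height e z| < 2} := by
      ext z
      change plaquePoint c z ∈ X ∪ (PoleCurve.through (s := s) e₀).carrier ↔ _
      simp only [Set.mem_union, Set.mem_iUnion, Set.mem_preimage, s.plaquePoint_mem_carrier_iff,
        exists_prop]
      constructor
      · rintro (hz | ⟨e, he, hc, h0⟩)
        · exact .inl hz
        · exact .inr ⟨e, he, hc, by simp [h0]⟩
      · rintro (hz | ⟨e, he, rfl, h2⟩)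
        · exact .inl hz
        · by_cases h0 : s.height e z = 0
          · exact .inr ⟨e, he, rfl, h0⟩
          · exact .inl (h e he z h2 h0)
    rw [this]
    refine (hX.preimage (continuous_plaquePoint c)).union ?_
    exact isOpen_biUnion fun e _ => isOpen_iUnion fun _ =>
      isOpen_lt (s.continuous_height e).abs continuous_const
  · have : Sum.inr ⁻¹' (surfaceMk ⁻¹' (X ∪ (PoleCurve.through (s := s) e₀).carrier)) =
        (fun x => surfaceMk (G := G) (.inr x)) ⁻¹' X := by
      ext x
      change surfaceMk (.inr x) ∈ X ∪ (PoleCurve.through (s := s) e₀).carrier ↔ _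
      rw [Set.mem_union, s.mem_carrier_iff]
      simp
    rw [this]
    exact hX.preimage (isQuotientMap_surfaceMk.continuous.comp continuous_inr)

/-- A pole curve of positive index does not separate a surface that contains the surface of the
abstract link diagram as an open subsurface. -/
theorem PoleState.not_isSeparating_through {F : Type*} [TopologicalSpace F] [T2Space F]
    [LocallyConnectedSpace F] {f : G.Surface → F} (hf : Topology.IsOpenEmbedding f) {k : ℕ}
    (hk : HasIndex (PoleCurve.through (s := s) e₀).poles k) (hpos : 0 < k) :
    ¬ IsSeparating (f '' (PoleCurve.through (s := s) e₀).carrier) := by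
  rintro ⟨x, hx, y, hy, hxy, hne⟩
  set l := (PoleCurve.through (s := s) e₀).carrier with hl
  -- Compactness of the curve and the Hausdorff property make its image closed, so by local
  -- connectedness the components of the complement are open.
  have hC : IsClosed (f '' l) := ((s.isCompact_carrier e₀).image hf.continuous).isClosed
  set U := connectedComponentIn (f '' l)ᶜ x with hU
  have hUC : U ⊆ (f '' l)ᶜ := connectedComponentIn_subset _ _
  have hUopen : IsOpen U := hC.isOpen_compl.connectedComponentIn
  have hcomp : ∀ {z}, z ∈ (f '' l)ᶜ → z ∉ U → connectedComponentIn (f '' l)ᶜ z ⊆ Uᶜ := by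
    intro z hz hzU w hw hwU
    rw [hU, connectedComponentIn_eq hwU, ← connectedComponentIn_eq hw] at hzU
    exact hzU (mem_connectedComponentIn hz)
  have hVopen : IsOpen ((f '' l)ᶜ \ U) := by
    rw [isOpen_iff_mem_nhds]
    rintro z ⟨hz, hzU⟩
    refine Filter.mem_of_superset ((hC.isOpen_compl.connectedComponentIn).mem_nhds
      (mem_connectedComponentIn hz)) fun w hw => ⟨connectedComponentIn_subset _ _ hw, ?_⟩
    exact hcomp hz hzU hw
  have hyU : y ∉ U := fun h => hne (connectedComponentIn_eq h)
  have hX : IsComponentUnion l (f ⁻¹' U) := by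
    rintro B hB hBl ⟨z, hzB, hzU⟩ w hw
    have h1 : f '' B ⊆ (f '' l)ᶜ := by
      rintro _ ⟨b, hb, rfl⟩ ⟨b', hb', h⟩
      rw [hf.injective h] at hb'
      exact hBl hb hb'
    have h2 := (hB.image f hf.continuous.continuousOn).subset_connectedComponentIn
      (Set.mem_image_of_mem f hzB) h1
    rw [hU, connectedComponentIn_eq hzU]
    exact h2 (Set.mem_image_of_mem f hw)
  have hsides : ∀ e ∈ s.orbit e₀, ∀ z, |s.height e z| < 2 → s.height e z ≠ 0 →
      (plaquePoint (arrivalCrossing e) z ∈ f ⁻¹' U ↔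
        plaquePoint (arrivalCrossing e₀) (entryPoint e₀ halfOffset) ∈ f ⁻¹' U) := by
    intro e he z h2 h0
    rcases lt_or_gt_of_ne h0 with h | h
    · rw [left_iff_right hX hk hpos]
      exact mem_iff_right hX e he z ⟨(abs_lt.mp h2).1, h⟩
    · exact mem_iff_left hX e he z ⟨h, (abs_lt.mp h2).2⟩
  have hopen : ∀ {W : Set F}, IsOpen W → (∀ e ∈ s.orbit e₀, ∀ z, |s.height e z| < 2 →
      s.height e z ≠ 0 → plaquePoint (arrivalCrossing e) z ∈ f ⁻¹' W) →
      IsOpen (W ∪ f '' l) := by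
    intro W hW h
    have := hW.union (hf.isOpenMap _ (isOpen_union_carrier (hW.preimage hf.continuous) h))
    rwa [Set.image_union, ← Set.union_assoc,
      Set.union_eq_self_of_subset_right (Set.image_preimage_subset f W)] at this
  -- Both sides now have the same status: either `U ∪ f '' l` or `U` is open and closed. It contains
  -- `x`, hence the whole component of `x`, but not `y`.
  by_cases hleft : plaquePoint (arrivalCrossing e₀) (entryPoint e₀ halfOffset) ∈ f ⁻¹' U
  · have h1 : IsOpen (U ∪ f '' l) := hopen hUopen fun e he z h2 h0 => (hsides e he z h2 h0).mpr hleft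
    have h2 : IsClosed (U ∪ f '' l) := by
      rw [← isOpen_compl_iff, Set.compl_union, Set.inter_comm]
      exact hVopen
    have := IsClopen.connectedComponent_subset ⟨h2, h1⟩
      (show x ∈ U ∪ f '' l from .inl (mem_connectedComponentIn hx))
    rw [hxy] at this
    exact (this mem_connectedComponent).elim hyU hy
  · have h1 : IsOpen ((f '' l)ᶜ \ U ∪ f '' l) := hopen hVopen fun e he z h2 h0 => by
      refine ⟨?_, fun h => hleft ((hsides e he z h2 h0).mp h)⟩
      rintro ⟨w, hw, h⟩
      rw [hf.injective h] at hw
      exact s.notMem_carrier_of_mem_orbit e₀ h2 h0 hw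
    have e1 : (f '' l)ᶜ \ U ∪ f '' l = Uᶜ := by
      ext z
      by_cases hz : z ∈ f '' l
      · simpa [hz] using fun h => hUC h hz
      · simp only [Set.mem_union, Set.mem_sdiff, Set.mem_compl_iff, hz, not_false_eq_true, true_and,
          or_false]
    rw [e1] at h1
    have := IsClopen.connectedComponent_subset ⟨isOpen_compl_iff.mp h1, hUopen⟩
      (mem_connectedComponentIn hx)
    rw [hxy] at this
    exact hyU (this mem_connectedComponent)

end GaussDiagram

theorem HasIndex.eq_zero_of_nil {k : ℕ} (h : HasIndex Cycle.nil k) : k = 0 :=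
  HasIndex.eq_zero (w := []) (b := true) (a₁ := 0) (a₂ := 1) h rfl (by norm_num) rfl rfl

theorem corollary1 (D : VirtualLinkDiagram) {F : Type*} [TopologicalSpace F] [T2Space F]
    [CompactSpace F] [ChartedSpace (EuclideanSpace ℝ (Fin 2)) F] (f : D.Realization F)
    (s : D.gaussDiagram.PoleState) (l : GaussDiagram.PoleCurve s) (k : ℕ)
    (hk : HasIndex l.poles k) (hpos : 0 < k) :
    ¬ IsSeparating (f.toFun '' l.carrier) := by
  cases l with
  | through e =>
    have := ChartedSpace.locallyConnectedSpace (EuclideanSpace ℝ (Fin 2)) F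
    exact GaussDiagram.PoleState.not_isSeparating_through f.isOpenEmbedding hk hpos
  | free i => exact absurd hk.eq_zero_of_nil hpos.ne'
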